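/- Let $n\ge 2$, let $S^{n-1}=\{x\in\mathbb R^n:|x|=1\}$, and let $\sigma_{n-1}$ be the normalized Lebesgue (uniform probability) measure on $S^{n-1}$. For a $C^2$-smooth function $f$ on $S^{n-1}$ and $\theta\in S^{n-1}$, let $\nabla_S f(\theta)\in\mathbb R^n$ be the vector $v$ of smallest Euclidean norm such that $$f(\theta')=f(\theta)+\langle v,\theta'-\theta\rangle+o(|\theta'-\theta|)\qquad(\theta'\to\theta,\ \theta'\in S^{n-1}),$$ let $f''_S(\theta)$ be the real $n\times n$ matrix $B$ of smallest Hilbert–Schmidt norm $\|B\|_{\rm HS}=\big(\sum_{i,j}B_{ij}^2\big)^{1/2}$ such that $$f(\theta')=f(\theta)+\langle\nabla_S f(\theta),\theta'-\theta\rangle+\tfrac12\langle B(\theta'-\theta),\theta'-\theta\rangle+o(|\theta'-\theta|^2)\qquad(\theta'\to\theta,\ \theta'\in S^{n-1}),$$ and let $\Delta_S f=\operatorname{Tr} f''_S$ be the spherical Laplacian, with $\Delta_S^2f=\Delta_S(\Delta_S f)$. Then for every $C^4$-smooth function $f:S^{n-1}\to\mathbb R$, both integrands below are $\sigma_{n-1}$-integrable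 and $$\int \|f''_S\|_{\rm HS}^2\,d\sigma_{n-1}=\int f\,\big(\Delta_S^2 f+(n-2)\,\Delta_S f\big)\,d\sigma_{n-1}.$$ -/

import Mathlib

open MeasureTheory Asymptotics Filter
open scoped Topology Manifold RealInnerProductSpace

noncomputable section

/-- The unit sphere `S^{n-1}` of Euclidean `n`-space. -/
abbrev UnitSphere (n : ℕ) : Type := Metric.sphere (0 : EuclideanSpace ℝ (Fin n)) 1

/-- For `n ≥ 2` the dimension of Euclidean `n`-space is `(n - 1) + 1`; this makes Mathlib's
`(n - 1)`-dimensional manifold structure on `UnitSphere n` available. -/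
instance factFinrankEuclidean (n : ℕ) [hn : Fact (2 ≤ n)] :
    Fact (Module.finrank ℝ (EuclideanSpace ℝ (Fin n)) = (n - 1) + 1) :=
  ⟨by have := hn.out; rw [finrank_euclideanSpace_fin]; omega⟩

namespace UnitSphere

variable {n : ℕ}

/-- The normalized (uniform, probability) Lebesgue surface measure `σ_{n-1}` on the unit sphere. -/
def sigma (n : ℕ) : Measure (UnitSphere n) :=
  ((volume : Measure (EuclideanSpace ℝ (Fin n))).toSphere Set.univ)⁻¹ •
    (volume : Measure (EuclideanSpace ℝ (Fin n))).toSphere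

/-- `f(θ') = f(θ) + ⟨v, θ' - θ⟩ + o(|θ' - θ|)` as `θ' → θ` along the sphere. -/
def HasTaylorOne (f : UnitSphere n → ℝ) (θ : UnitSphere n) (v : EuclideanSpace ℝ (Fin n)) :
    Prop :=
  (fun θ' : UnitSphere n => f θ' - f θ - ⟪v, (θ' : EuclideanSpace ℝ (Fin n)) - θ⟫) =o[𝓝 θ]
    fun θ' : UnitSphere n => ‖(θ' : EuclideanSpace ℝ (Fin n)) - θ‖

/-- `v` is the shortest vector satisfying the first order Taylor expansion of `f` at `θ`. -/
def IsGradient (f : UnitSphere n → ℝ) (θ : UnitSphere n) (v : EuclideanSpace ℝ (Fin n)) : Prop :=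
  HasTaylorOne f θ v ∧ ∀ w, HasTaylorOne f θ w → ‖v‖ ≤ ‖w‖

open Classical in
/-- The spherical gradient `∇_S f(θ)`: the shortest vector satisfying the first order Taylor
expansion (with the default value `0` if there is none). -/
def gradient (f : UnitSphere n → ℝ) (θ : UnitSphere n) : EuclideanSpace ℝ (Fin n) :=
  if h : ∃ v, IsGradient f θ v then h.choose else 0

/-- The Hilbert-Schmidt norm `(∑ B_ij²)^{1/2}` of an `n × n` matrix. -/
def hsNorm (B : Matrix (Fin n) (Fin n) ℝ) : ℝ := √(∑ i, ∑ j, B i j ^ 2)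

/-- `f(θ') = f(θ) + ⟨∇_S f(θ), θ' - θ⟩ + ½ ⟨B (θ' - θ), θ' - θ⟩ + o(|θ' - θ|²)` as `θ' → θ`
along the sphere. -/
def HasTaylorTwo (f : UnitSphere n → ℝ) (θ : UnitSphere n) (B : Matrix (Fin n) (Fin n) ℝ) :
    Prop :=
  (fun θ' : UnitSphere n =>
      f θ' - f θ - ⟪gradient f θ, (θ' : EuclideanSpace ℝ (Fin n)) - θ⟫
        - 1 / 2 * ⟪Matrix.toEuclideanLin B ((θ' : EuclideanSpace ℝ (Fin n)) - θ),
            (θ' : EuclideanSpace ℝ (Fin n)) - θ⟫) =o[𝓝 θ]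
    fun θ' : UnitSphere n => ‖(θ' : EuclideanSpace ℝ (Fin n)) - θ‖ ^ 2

/-- `B` has the smallest Hilbert-Schmidt norm among the matrices satisfying the second order
Taylor expansion of `f` at `θ`. -/
def IsHessian (f : UnitSphere n → ℝ) (θ : UnitSphere n) (B : Matrix (Fin n) (Fin n) ℝ) : Prop :=
  HasTaylorTwo f θ B ∧ ∀ A, HasTaylorTwo f θ A → hsNorm B ≤ hsNorm A

open Classical in
/-- The spherical second derivative `f''_S(θ)`: the `n × n` matrix of smallest Hilbert-Schmidt
norm satisfying the second order Taylor expansion (with the default value `0` if there is none). -/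
def hessian (f : UnitSphere n → ℝ) (θ : UnitSphere n) : Matrix (Fin n) (Fin n) ℝ :=
  if h : ∃ B, IsHessian f θ B then h.choose else 0

/-- The spherical Laplacian `Δ_S f = Tr f''_S`. -/
def laplacian (f : UnitSphere n → ℝ) (θ : UnitSphere n) : ℝ := (hessian f θ).trace

end UnitSphere

end

/-!
The function `f` is extended to `F(x) = f(x / ‖x‖)`, which is homogeneous of degree `0`, and the
spherical derivatives of `f` are read off from the Euclidean ones of `F`. By Euler's identity
`∇F(θ)` is tangent, so it is the spherical gradient, and `D²F(θ) θ = -∇F(θ)`. Hence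
`B = D²F + ∇F ⊗ θ + θ ⊗ ∇F` is symmetric and annihilates `θ`; it satisfies the second order
expansion and is Hilbert-Schmidt orthogonal to the difference with any other matrix that does, so
`f''_S = B` (`UnitSphere.hessian_eq`). On the sphere this gives `Δ_S f = ΔF`
(`UnitSphere.laplacian_eq`) and `‖f''_S‖² = ‖D²F‖² - 2 ‖∇F‖²` (`UnitSphere.hsNorm_hessian_sq`).
Since `ΔF` is homogeneous of degree `-2`, the `0`-homogeneous extension of `Δ_S f` is
`G = ‖x‖² ΔF`, and `Δ_S² f = ΔG` on the sphere.

The integral identities come from one divergence theorem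
(`EuclideanCalculus.integral_sphere_divergence`): if a vector field is tangent to the spheres around
the origin and its divergence is homogeneous, then the divergence has integral zero over the unit
sphere. Applied to `u ∇v` it gives Green's formula (`EuclideanCalculus.integral_mul_lap`), so that
`∫ f Δ_S² f = ∫ (ΔF)²` and `∫ f Δ_S f = -∫ ‖∇F‖²`. Applied to the tangential part of
`ΔF ∇F - D²F ∇F` it gives `∫ (ΔF)² = ∫ ‖D²F‖² + (n - 4) ∫ ‖∇F‖²`
(`EuclideanCalculus.integral_lap_sq`). Combining,
`∫ ‖f''_S‖² = ∫ (ΔF)² - (n - 2) ∫ ‖∇F‖² = ∫ f (Δ_S² f + (n - 2) Δ_S f)`.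
-/

/-! ### Partial derivatives and homogeneous functions on Euclidean space -/

namespace EuclideanCalculus

variable {n : ℕ}

/-- The `i`-th partial derivative of a function on Euclidean space. -/
noncomputable def pd (i : Fin n) (u : EuclideanSpace ℝ (Fin n) → ℝ)
    (x : EuclideanSpace ℝ (Fin n)) : ℝ :=
  fderiv ℝ u x (EuclideanSpace.single i 1)

/-- The function is `C^m` at each point other than the origin. -/
def SmoothOff (m : ℕ) (u : EuclideanSpace ℝ (Fin n) → ℝ) : Prop :=
  ∀ x, x ≠ 0 → ContDiffAt ℝ m u x

/-- Positive homogeneity of integer degree `k`. The origin is included: it forces `u 0 = 0` when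
`k ≠ 0`, and lets homogeneity pass to partial derivatives without excluding a point. -/
def IsHomog (k : ℤ) (u : EuclideanSpace ℝ (Fin n) → ℝ) : Prop :=
  ∀ t : ℝ, 0 < t → ∀ x, u (t • x) = t ^ k * u x

variable {u v : EuclideanSpace ℝ (Fin n) → ℝ} {x : EuclideanSpace ℝ (Fin n)}

lemma eq_sum_single (h : EuclideanSpace ℝ (Fin n)) :
    h = ∑ i, h i • EuclideanSpace.single i (1 : ℝ) := by
  conv_lhs => rw [← (EuclideanSpace.basisFun (Fin n) ℝ).sum_repr h]
  simp

lemma apply_eq_sum (A : EuclideanSpace ℝ (Fin n) →L[ℝ] ℝ) (h : EuclideanSpace ℝ (Fin n)) :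
    A h = ∑ i, h i * A (EuclideanSpace.single i 1) := by
  conv_lhs => rw [eq_sum_single h]
  simp

lemma fderiv_apply_eq_sum (u : EuclideanSpace ℝ (Fin n) → ℝ) (x h : EuclideanSpace ℝ (Fin n)) :
    fderiv ℝ u x h = ∑ i, h i * pd i u x :=
  apply_eq_sum _ h

lemma pd_mul (i : Fin n) (hu : DifferentiableAt ℝ u x) (hv : DifferentiableAt ℝ v x) :
    pd i (fun y => u y * v y) x = u x * pd i v x + v x * pd i u x := by
  simp [pd, fderiv_fun_mul hu hv]

lemma pd_sub (i : Fin n) (hu : DifferentiableAt ℝ u x) (hv : DifferentiableAt ℝ v x) :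
    pd i (fun y => u y - v y) x = pd i u x - pd i v x := by
  simp [pd, fderiv_fun_sub hu hv]

lemma pd_sum (i : Fin n) {ι : Type*} (s : Finset ι) {w : ι → EuclideanSpace ℝ (Fin n) → ℝ}
    (hw : ∀ j ∈ s, DifferentiableAt ℝ (w j) x) :
    pd i (fun y => ∑ j ∈ s, w j y) x = ∑ j ∈ s, pd i (w j) x := by
  simp [pd, fderiv_fun_sum hw]

lemma pd_congr (i : Fin n) (h : u =ᶠ[𝓝 x] v) : pd i u x = pd i v x := by
  simp [pd, h.fderiv_eq]

lemma pd_coord (i j : Fin n) :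
    pd i (fun y : EuclideanSpace ℝ (Fin n) => y j) x = if j = i then 1 else 0 := by
  have : HasFDerivAt (fun y : EuclideanSpace ℝ (Fin n) => y j)
      (EuclideanSpace.proj j : EuclideanSpace ℝ (Fin n) →L[ℝ] ℝ) x :=
    (EuclideanSpace.proj j : EuclideanSpace ℝ (Fin n) →L[ℝ] ℝ).hasFDerivAt
  rw [pd, this.fderiv]
  simp

lemma pd_norm_sq (i : Fin n) : pd i (fun y : EuclideanSpace ℝ (Fin n) => ‖y‖ ^ 2) x = 2 * x i := by
  rw [pd, (hasStrictFDerivAt_norm_sq x).hasFDerivAt.fderiv]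
  simp [EuclideanSpace.inner_single_right]

lemma contDiffAt_coord {m : WithTop ℕ∞} (i : Fin n) :
    ContDiffAt ℝ m (fun y : EuclideanSpace ℝ (Fin n) => y i) x := by
  fun_prop

lemma contDiffAt_pd {m : ℕ} (i : Fin n) (hu : ContDiffAt ℝ (m + 1 : ℕ) u x) :
    ContDiffAt ℝ m (pd i u) x := by
  have : ContDiffAt ℝ m (fderiv ℝ u) x := hu.fderiv_right (by norm_cast)
  exact this.clm_apply contDiffAt_const

lemma SmoothOff.pd {m : ℕ} (hu : SmoothOff (m + 1) u) (i : Fin n) : SmoothOff m (pd i u) :=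
  fun x hx => contDiffAt_pd i (hu x hx)

lemma SmoothOff.of_le {m k : ℕ} (hu : SmoothOff m u) (h : k ≤ m) : SmoothOff k u :=
  fun x hx => (hu x hx).of_le (by exact_mod_cast h)

lemma SmoothOff.differentiableAt {m : ℕ} (hu : SmoothOff m u) (hm : m ≠ 0) (hx : x ≠ 0) :
    DifferentiableAt ℝ u x :=
  (hu x hx).differentiableAt (by exact_mod_cast hm)

lemma SmoothOff.mul {m : ℕ} (hu : SmoothOff m u) (hv : SmoothOff m v) :
    SmoothOff m (fun x => u x * v x) :=
  fun x hx => (hu x hx).mul (hv x hx)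

lemma SmoothOff.sub {m : ℕ} (hu : SmoothOff m u) (hv : SmoothOff m v) :
    SmoothOff m (fun x => u x - v x) :=
  fun x hx => (hu x hx).sub (hv x hx)

lemma SmoothOff.sum {m : ℕ} {ι : Type*} {s : Finset ι} {w : ι → EuclideanSpace ℝ (Fin n) → ℝ}
    (hw : ∀ j, SmoothOff m (w j)) : SmoothOff m (fun x => ∑ j ∈ s, w j x) :=
  fun x hx => ContDiffAt.sum fun j _ => hw j x hx

lemma smoothOff_coord {m : ℕ} (i : Fin n) :
    SmoothOff m (fun y : EuclideanSpace ℝ (Fin n) => y i) :=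
  fun _ _ => contDiffAt_coord i

lemma smoothOff_norm_sq {m : ℕ} : SmoothOff m (fun y : EuclideanSpace ℝ (Fin n) => ‖y‖ ^ 2) :=
  fun _ _ => (contDiff_norm_sq ℝ).contDiffAt

lemma fderiv_fderiv_single (hu : ContDiffAt ℝ 2 u x) (i j : Fin n) :
    fderiv ℝ (fderiv ℝ u) x (EuclideanSpace.single i 1) (EuclideanSpace.single j 1)
      = pd i (pd j u) x := by
  have h1 : DifferentiableAt ℝ (fderiv ℝ u) x :=
    (hu.fderiv_right (m := 1) (by norm_num)).differentiableAt (by norm_num)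
  have : HasFDerivAt (pd j u) ((fderiv ℝ (fderiv ℝ u) x).flip (EuclideanSpace.single j 1)) x := by
    refine (h1.hasFDerivAt.clm_apply
      (hasFDerivAt_const (EuclideanSpace.single j (1 : ℝ)) x)).congr_fderiv ?_
    ext w
    simp
  rw [pd, this.fderiv]
  rfl

lemma pd_comm (hu : ContDiffAt ℝ 2 u x) (i j : Fin n) : pd i (pd j u) x = pd j (pd i u) x := by
  rw [← fderiv_fderiv_single hu, ← fderiv_fderiv_single hu]
  exact hu.isSymmSndFDerivAt (by simp) _ _

lemma IsHomog.pd {k : ℤ} (hu : IsHomog k u) (i : Fin n) : IsHomog (k - 1) (pd i u) := by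
  intro t ht x
  have h1 : fderiv ℝ (fun y => u (t • y)) x = t • fderiv ℝ u (t • x) := fderiv_comp_smul ..
  have h2 : (fun y => u (t • y)) = (t ^ k) • u := by
    ext y; simp [hu t ht y]
  rw [h2, fderiv_const_smul_field] at h1
  have h3 := congrArg (fun A => A (EuclideanSpace.single i (1 : ℝ))) h1
  simp only [Pi.smul_apply, smul_apply, smul_eq_mul] at h3
  have : EuclideanCalculus.pd i u (t • x) = t⁻¹ * (t ^ k * EuclideanCalculus.pd i u x) := by
    unfold EuclideanCalculus.pd
    rw [h3]; field_simp
  rw [this, zpow_sub_one₀ ht.ne']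
  ring

/-- Euler's identity for homogeneous functions. -/
lemma IsHomog.euler {k : ℤ} (hu : IsHomog k u) (hx : DifferentiableAt ℝ u x) :
    ∑ i, x i * EuclideanCalculus.pd i u x = k * u x := by
  rw [← fderiv_apply_eq_sum]
  have h1 : HasDerivAt (fun t : ℝ => t • x) x 1 := by
    simpa using (hasDerivAt_id (1 : ℝ)).smul_const x
  have h2 : HasDerivAt (fun t : ℝ => u (t • x)) (fderiv ℝ u x x) 1 := by
    have hd : HasFDerivAt u (fderiv ℝ u x) ((1 : ℝ) • x) := by simpa using hx.hasFDerivAt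
    exact hd.comp_hasDerivAt (1 : ℝ) h1
  have h3 : HasDerivAt (fun t : ℝ => t ^ k * u x) (k * u x) 1 := by
    simpa using (hasDerivAt_zpow k (1 : ℝ) (Or.inl one_ne_zero)).mul_const (u x)
  refine h2.unique (h3.congr_of_eventuallyEq ?_)
  filter_upwards [lt_mem_nhds (zero_lt_one (α := ℝ))] with t ht using hu t ht x

lemma IsHomog.mul {k l : ℤ} (hu : IsHomog k u) (hv : IsHomog l v) :
    IsHomog (k + l) (fun x => u x * v x) := by
  intro t ht x
  beta_reduce
  rw [hu t ht, hv t ht, zpow_add₀ ht.ne']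
  ring

lemma IsHomog.add {k : ℤ} (hu : IsHomog k u) (hv : IsHomog k v) :
    IsHomog k (fun x => u x + v x) := by
  intro t ht x
  beta_reduce
  rw [hu t ht, hv t ht]
  ring

lemma IsHomog.sub {k : ℤ} (hu : IsHomog k u) (hv : IsHomog k v) :
    IsHomog k (fun x => u x - v x) := by
  intro t ht x
  beta_reduce
  rw [hu t ht, hv t ht]
  ring

lemma IsHomog.const_mul {k : ℤ} (c : ℝ) (hu : IsHomog k u) :
    IsHomog k (fun x => c * u x) := by
  intro t ht x
  beta_reduce
  rw [hu t ht]
  ring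

lemma IsHomog.sum {k : ℤ} {ι : Type*} {s : Finset ι} {w : ι → EuclideanSpace ℝ (Fin n) → ℝ}
    (hw : ∀ j, IsHomog k (w j)) : IsHomog k (fun x => ∑ j ∈ s, w j x) := by
  intro t ht x
  simp only [fun j => hw j t ht x, Finset.mul_sum]

lemma isHomog_norm_sq : IsHomog 2 (fun y : EuclideanSpace ℝ (Fin n) => ‖y‖ ^ 2) := by
  intro t ht x
  beta_reduce
  rw [norm_smul, mul_pow, Real.norm_of_nonneg ht.le]
  norm_cast

lemma sum_mul_pd (hu : IsHomog 0 u) (hd : DifferentiableAt ℝ u x) :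
    ∑ j, x j * pd j u x = 0 := by
  rw [hu.euler hd]
  simp

/-- Euler's identity for the partial derivatives of a `0`-homogeneous function: the Hessian maps
`x` to `-∇u(x)`. -/
lemma sum_mul_pd_pd (hu : IsHomog 0 u) (hc : ContDiffAt ℝ 2 u x)
    (i : Fin n) : ∑ j, x j * pd i (pd j u) x = - pd i u x := by
  have h := (hu.pd i).euler ((contDiffAt_pd i hc).differentiableAt (by norm_num))
  simp only [pd_comm hc _ i] at h
  simpa using h

/-- Second order Taylor expansion with Peano remainder. -/
lemma taylor_two (hu : ContDiffAt ℝ 2 u x) :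
    (fun y => u y - u x - fderiv ℝ u x (y - x) - 1 / 2 * fderiv ℝ (fderiv ℝ u) x (y - x) (y - x))
      =o[𝓝 x] fun y => ‖y - x‖ ^ 2 := by
  set Q := fderiv ℝ (fderiv ℝ u) x
  have hsymm : ∀ a b, Q a b = Q b a := fun a b => hu.isSymmSndFDerivAt (by simp) a b
  have h1 : HasFDerivAt (fderiv ℝ u) Q x :=
    ((hu.fderiv_right (m := 1) (by norm_num)).differentiableAt (by norm_num)).hasFDerivAt
  have hd : ∀ᶠ y in 𝓝 x, DifferentiableAt ℝ u y := by
    filter_upwards [hu.eventually (by simp)] with y hy using hy.differentiableAt (by norm_num)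
  rw [isLittleO_iff]
  intro ε hε
  obtain ⟨δ, hδ, hball⟩ := Metric.eventually_nhds_iff_ball.1
    (hd.and ((isLittleO_iff.1 h1.isLittleO) hε))
  filter_upwards [Metric.ball_mem_nhds x hδ] with y hy
  set R : EuclideanSpace ℝ (Fin n) → ℝ :=
    fun z => u z - u x - fderiv ℝ u x (z - x) - 1 / 2 * Q (z - x) (z - x) with hR
  have hsub : Metric.closedBall x ‖y - x‖ ⊆ Metric.ball x δ := by
    apply Metric.closedBall_subset_ball
    simpa [dist_eq_norm] using hy
  have hRd : ∀ z ∈ Metric.closedBall x ‖y - x‖,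
      HasFDerivWithinAt R (fderiv ℝ u z - fderiv ℝ u x - Q (z - x))
        (Metric.closedBall x ‖y - x‖) z := by
    intro z hz
    have e1 : HasFDerivAt (fun z => z - x) (ContinuousLinearMap.id ℝ _) z :=
      (hasFDerivAt_id z).sub_const x
    have e2 : HasFDerivAt (fun z => Q (z - x) (z - x)) ((2 : ℝ) • Q (z - x)) z := by
      have := (Q.hasFDerivAt.comp z e1).clm_apply e1
      refine this.congr_fderiv ?_
      ext w
      have := hsymm w (z - x)
      simp only [map_sub, sub_apply] at this
      simp [this, two_mul]
    have e3 : HasFDerivAt (fun z => fderiv ℝ u x (z - x)) (fderiv ℝ u x) z := by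
      exact (fderiv ℝ u x).hasFDerivAt.comp z e1
    have e4 := ((((hball z (hsub hz)).1.hasFDerivAt.sub_const (u x)).sub e3).sub
      (e2.const_mul (1 / 2)))
    refine (e4.congr_fderiv ?_).hasFDerivWithinAt
    ext w
    simp
  have hbound : ∀ z ∈ Metric.closedBall x ‖y - x‖,
      ‖fderiv ℝ u z - fderiv ℝ u x - Q (z - x)‖ ≤ ε * ‖y - x‖ := by
    intro z hz
    refine ((hball z (hsub hz)).2).trans ?_
    gcongr
    simpa [dist_eq_norm] using hz
  have := (convex_closedBall x ‖y - x‖).norm_image_sub_le_of_norm_hasFDerivWithin_le hRd hbound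
    (Metric.mem_closedBall_self (norm_nonneg _))
    (show y ∈ Metric.closedBall x ‖y - x‖ by simp [dist_eq_norm])
  have hRx : R x = 0 := by simp [hR]
  rw [hRx, sub_zero] at this
  refine this.trans (le_of_eq ?_)
  rw [Real.norm_of_nonneg (by positivity)]
  ring

end EuclideanCalculus

/-! ### Spherical derivatives of the restriction of a homogeneous function -/

namespace UnitSphere

open EuclideanCalculus

variable {n : ℕ}

lemma norm_coe (θ : UnitSphere n) : ‖(θ : EuclideanSpace ℝ (Fin n))‖ = 1 :=
  norm_eq_of_mem_sphere θ

lemma coe_ne_zero (θ : UnitSphere n) : (θ : EuclideanSpace ℝ (Fin n)) ≠ 0 :=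
  ne_zero_of_mem_unit_sphere θ

lemma inner_sub_self (θ θ' : UnitSphere n) :
    ⟪(θ : EuclideanSpace ℝ (Fin n)), (θ' : EuclideanSpace ℝ (Fin n)) - θ⟫
      = -(1 / 2) * ‖(θ' : EuclideanSpace ℝ (Fin n)) - θ‖ ^ 2 := by
  rw [norm_sub_sq_real, norm_coe, norm_coe, inner_sub_right, real_inner_self_eq_norm_sq, norm_coe,
    real_inner_comm]
  ring

/-- Every tangent vector is the velocity of a curve on the sphere, namely of a great circle. -/
lemma exists_hasDerivAt (θ : UnitSphere n) {e : EuclideanSpace ℝ (Fin n)}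
    (he : ⟪(θ : EuclideanSpace ℝ (Fin n)), e⟫ = 0) :
    ∃ γ : ℝ → UnitSphere n, γ 0 = θ ∧
      HasDerivAt (fun t => (γ t : EuclideanSpace ℝ (Fin n))) e 0 := by
  rcases eq_or_ne e 0 with rfl | hne
  · exact ⟨fun _ => θ, rfl, hasDerivAt_const _ _⟩
  have hpos : ‖e‖ ≠ 0 := norm_ne_zero_iff.2 hne
  let c : ℝ → EuclideanSpace ℝ (Fin n) :=
    fun t => Real.cos (t * ‖e‖) • (θ : EuclideanSpace ℝ (Fin n)) + (Real.sin (t * ‖e‖) / ‖e‖) • e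
  have hc : ∀ t, c t ∈ Metric.sphere (0 : EuclideanSpace ℝ (Fin n)) 1 := by
    intro t
    have : ‖c t‖ ^ 2 = 1 := by
      simp only [c]
      rw [norm_add_sq_real, inner_smul_left, inner_smul_right, he, norm_smul, norm_smul, norm_coe,
        mul_pow, mul_pow, Real.norm_eq_abs, Real.norm_eq_abs, sq_abs, sq_abs]
      field_simp
      rw [mul_zero, add_zero, ← mul_add, Real.cos_sq_add_sin_sq, mul_one]
    rw [mem_sphere_zero_iff_norm]
    nlinarith [norm_nonneg (c t)]
  refine ⟨fun t => ⟨c t, hc t⟩, Subtype.ext (by simp [c]), ?_⟩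
  have h1 : HasDerivAt (fun t : ℝ => t * ‖e‖) ‖e‖ 0 := by
    simpa using (hasDerivAt_id (0 : ℝ)).mul_const ‖e‖
  have h2 : HasDerivAt c _ 0 := (h1.cos.smul_const (θ : EuclideanSpace ℝ (Fin n))).add
    ((h1.sin.div_const ‖e‖).smul_const e)
  exact h2.congr_deriv (by simp [hpos])

/-- A homogeneous polynomial of degree `m` in `θ' - θ` which is negligible to order `m` along the
sphere vanishes on the tangent space. -/
lemma eq_zero_of_isLittleO (θ : UnitSphere n) {q : EuclideanSpace ℝ (Fin n) → ℝ} {m : ℕ}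
    (hq : Continuous q) (hm : ∀ (c : ℝ) h, q (c • h) = c ^ m * q h)
    (ho : (fun θ' : UnitSphere n => q ((θ' : EuclideanSpace ℝ (Fin n)) - θ)) =o[𝓝 θ]
      fun θ' : UnitSphere n => ‖(θ' : EuclideanSpace ℝ (Fin n)) - θ‖ ^ m)
    {e : EuclideanSpace ℝ (Fin n)} (he : ⟪(θ : EuclideanSpace ℝ (Fin n)), e⟫ = 0) : q e = 0 := by
  obtain ⟨γ, hγ0, hγ⟩ := exists_hasDerivAt θ he
  have h1 : Tendsto (fun t => q (t⁻¹ • ((γ t : EuclideanSpace ℝ (Fin n)) - θ))) (𝓝[≠] 0)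
      (𝓝 (q e)) := by
    have := (hasDerivAt_iff_tendsto_slope.1 hγ)
    refine (hq.tendsto e).comp (this.congr fun t => ?_)
    simp [slope_def_module, hγ0]
  have hcont : Tendsto γ (𝓝 0) (𝓝 θ) := by
    rw [tendsto_subtype_rng]
    simpa [hγ0] using hγ.continuousAt.tendsto
  have h2 : (fun t => q ((γ t : EuclideanSpace ℝ (Fin n)) - θ)) =o[𝓝 0] fun t : ℝ => t ^ m := by
    have hO : (fun t => (γ t : EuclideanSpace ℝ (Fin n)) - θ) =O[𝓝 0] fun t : ℝ => t := by
      simpa [hγ0] using hγ.differentiableAt.isBigO_sub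
    exact (ho.comp_tendsto hcont).trans_isBigO (hO.norm_left.pow m)
  have h3 : Tendsto (fun t => q (t⁻¹ • ((γ t : EuclideanSpace ℝ (Fin n)) - θ))) (𝓝[≠] 0)
      (𝓝 0) := by
    refine (h2.tendsto_div_nhds_zero.mono_left nhdsWithin_le_nhds).congr fun t => ?_
    rw [hm, inv_pow]
    ring
  exact tendsto_nhds_unique h1 h3

/-- The Euclidean gradient, written in coordinates. -/
noncomputable def euclGrad (F : EuclideanSpace ℝ (Fin n) → ℝ) (x : EuclideanSpace ℝ (Fin n)) :
    EuclideanSpace ℝ (Fin n) :=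
  WithLp.toLp 2 fun i => pd i F x

lemma inner_euclGrad (F : EuclideanSpace ℝ (Fin n) → ℝ) (x h : EuclideanSpace ℝ (Fin n)) :
    ⟪euclGrad F x, h⟫ = fderiv ℝ F x h := by
  rw [fderiv_apply_eq_sum, PiLp.inner_apply]
  simp [euclGrad]

variable {f : UnitSphere n → ℝ} {F : EuclideanSpace ℝ (Fin n) → ℝ} {θ : UnitSphere n}

lemma inner_euclGrad_self (hF : IsHomog 0 F) (hd : DifferentiableAt ℝ F θ) :
    ⟪euclGrad F θ, (θ : EuclideanSpace ℝ (Fin n))⟫ = 0 := by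
  rw [inner_euclGrad, fderiv_apply_eq_sum, hF.euler hd]
  simp

lemma tendsto_coe (θ : UnitSphere n) :
    Tendsto (fun θ' : UnitSphere n => (θ' : EuclideanSpace ℝ (Fin n))) (𝓝 θ)
      (𝓝 (θ : EuclideanSpace ℝ (Fin n))) :=
  continuous_subtype_val.tendsto θ

lemma hasTaylorOne_euclGrad (hfF : ∀ θ : UnitSphere n, F θ = f θ) (hd : DifferentiableAt ℝ F θ) :
    HasTaylorOne f θ (euclGrad F θ) := by
  have := (hd.hasFDerivAt.isLittleO.comp_tendsto (tendsto_coe θ)).norm_right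
  simpa [HasTaylorOne, Function.comp_def, hfF, inner_euclGrad] using this

/-- The first order expansion determines its vector up to a normal component. -/
lemma HasTaylorOne.inner_sub_eq_zero {v w e : EuclideanSpace ℝ (Fin n)} (hv : HasTaylorOne f θ v)
    (hw : HasTaylorOne f θ w) (he : ⟪(θ : EuclideanSpace ℝ (Fin n)), e⟫ = 0) :
    ⟪w - v, e⟫ = 0 := by
  refine eq_zero_of_isLittleO θ (q := fun h => ⟪w - v, h⟫) (m := 1) (by fun_prop)
    (fun c h => by simp [inner_smul_right]) ?_ he
  simp only [pow_one]
  refine (hv.sub hw).congr_left fun θ' => ?_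
  simp only [inner_sub_left, inner_sub_right]
  ring

lemma HasTaylorOne.norm_sq_eq {v w : EuclideanSpace ℝ (Fin n)} (hv : HasTaylorOne f θ v)
    (hvθ : ⟪v, (θ : EuclideanSpace ℝ (Fin n))⟫ = 0) (hw : HasTaylorOne f θ w) :
    ‖w‖ ^ 2 = ‖v‖ ^ 2 + ‖w - v‖ ^ 2 := by
  have h := hv.inner_sub_eq_zero hw
    (by rwa [real_inner_comm] : ⟪(θ : EuclideanSpace ℝ (Fin n)), v⟫ = 0)
  have : w = (w - v) + v := by abel
  conv_lhs => rw [this]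
  rw [norm_add_sq_real, h]
  ring

/-- A tangent vector satisfying the first order expansion is the spherical gradient. -/
lemma gradient_eq_of_tangent {v : EuclideanSpace ℝ (Fin n)} (hv : HasTaylorOne f θ v)
    (hvθ : ⟪v, (θ : EuclideanSpace ℝ (Fin n))⟫ = 0) : gradient f θ = v := by
  have hex : ∃ v, IsGradient f θ v := by
    refine ⟨v, hv, fun w hw => ?_⟩
    have := hv.norm_sq_eq hvθ hw
    exact le_of_sq_le_sq (by nlinarith [sq_nonneg ‖w - v‖]) (norm_nonneg _)
  rw [gradient, dif_pos hex]
  obtain ⟨h1, h2⟩ := hex.choose_spec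
  have h3 := hv.norm_sq_eq hvθ h1
  have h4 := pow_le_pow_left₀ (norm_nonneg _) (h2 v hv) 2
  have h5 : ‖hex.choose - v‖ ^ 2 = 0 := le_antisymm (by linarith) (sq_nonneg _)
  exact sub_eq_zero.1 (norm_eq_zero.1 (pow_eq_zero_iff two_ne_zero |>.1 h5))

lemma gradient_eq (hfF : ∀ θ : UnitSphere n, F θ = f θ) (hF : IsHomog 0 F)
    (hd : DifferentiableAt ℝ F θ) : gradient f θ = euclGrad F θ :=
  gradient_eq_of_tangent (hasTaylorOne_euclGrad hfF hd) (inner_euclGrad_self hF hd)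

lemma inner_toEuclideanLin (B : Matrix (Fin n) (Fin n) ℝ) (x y : EuclideanSpace ℝ (Fin n)) :
    ⟪Matrix.toEuclideanLin B x, y⟫ = ∑ i, ∑ j, B i j * x j * y i := by
  rw [PiLp.inner_apply]
  refine Finset.sum_congr rfl fun i _ => ?_
  simp [Matrix.toLpLin_apply, Matrix.mulVec, dotProduct, Finset.mul_sum, mul_comm]

lemma hsNorm_sq (B : Matrix (Fin n) (Fin n) ℝ) : hsNorm B ^ 2 = ∑ i, ∑ j, B i j ^ 2 :=
  Real.sq_sqrt (Finset.sum_nonneg fun _ _ => Finset.sum_nonneg fun _ _ => sq_nonneg _)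

/-- A symmetric matrix that annihilates `θ` is Hilbert-Schmidt orthogonal to every matrix whose
quadratic form vanishes on the tangent space at `θ`. -/
lemma sum_mul_eq_zero {B Q : Matrix (Fin n) (Fin n) ℝ} (hB : ∀ i j, B i j = B j i)
    (hBθ : ∀ i, ∑ j, B i j * (θ : EuclideanSpace ℝ (Fin n)) j = 0)
    (hQ : ∀ e : EuclideanSpace ℝ (Fin n), ⟪(θ : EuclideanSpace ℝ (Fin n)), e⟫ = 0 →
      ⟪Matrix.toEuclideanLin Q e, e⟫ = 0) :
    ∑ i, ∑ j, B i j * Q i j = 0 := by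
  set x : EuclideanSpace ℝ (Fin n) := (θ : EuclideanSpace ℝ (Fin n)) with hx
  have hxx : ⟪x, x⟫ = 1 := by rw [real_inner_self_eq_norm_sq, hx, norm_coe]; norm_num
  set β : EuclideanSpace ℝ (Fin n) → EuclideanSpace ℝ (Fin n) → ℝ :=
    fun a b => ⟪Matrix.toEuclideanLin Q a, b⟫ with hβ
  let p : Fin n → EuclideanSpace ℝ (Fin n) :=
    fun i => EuclideanSpace.single i 1 - x i • x
  have hp : ∀ i, ⟪x, p i⟫ = 0 := by
    intro i
    simp only [p, inner_sub_right, inner_smul_right, hxx]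
    simp [EuclideanSpace.inner_single_right]
  have hpol : ∀ i j, β (p i) (p j) + β (p j) (p i) = 0 := by
    intro i j
    have h1 := hQ _ (hp i)
    have h2 := hQ _ (hp j)
    have h3 := hQ (p i + p j) (by rw [inner_add_right, hp, hp, add_zero])
    simp only [map_add, inner_add_left, inner_add_right] at h3
    simp only [hβ]
    linarith
  have hs : ∀ i j, β (EuclideanSpace.single i 1) (EuclideanSpace.single j 1) = Q j i := by
    intro i j
    simp [hβ, EuclideanSpace.inner_single_right, Matrix.toLpLin_apply]
  -- The symmetric part of `Q` is a symmetrized product of `x` with some vector.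
  obtain ⟨a, ha⟩ : ∃ a : Fin n → ℝ, ∀ i j, Q i j + Q j i = x i * a j + a i * x j := by
    refine ⟨fun i => β (EuclideanSpace.single i 1) x + β x (EuclideanSpace.single i 1)
      - x i * β x x, fun i j => ?_⟩
    have h := hpol i j
    have hexp : ∀ i j, β (p i) (p j) = Q j i - x j * β (EuclideanSpace.single i 1) x
        - x i * β x (EuclideanSpace.single j 1) + x i * x j * β x x := by
      intro i j
      rw [← hs i j]
      simp only [hβ, p, map_sub, map_smul, inner_sub_left, inner_sub_right, inner_smul_left,
        inner_smul_right, conj_trivial]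
      ring
    rw [hexp, hexp] at h
    linarith
  have h0 : ∑ i, ∑ j, B i j * (x i * a j + a i * x j) = 0 := by
    have e1 : ∑ i, ∑ j, B i j * (x i * a j) = 0 := by
      rw [Finset.sum_comm]
      refine Finset.sum_eq_zero fun j _ => ?_
      have := congrArg (fun s => s * a j) (hBθ j)
      simp only [Finset.sum_mul, zero_mul] at this
      rw [← this]
      exact Finset.sum_congr rfl fun i _ => by rw [hB i j]; ring
    have e2 : ∑ i, ∑ j, B i j * (a i * x j) = 0 := by
      refine Finset.sum_eq_zero fun i _ => ?_
      have := congrArg (fun s => s * a i) (hBθ i)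
      simp only [Finset.sum_mul, zero_mul] at this
      rw [← this]
      exact Finset.sum_congr rfl fun j _ => by ring
    simp only [mul_add, Finset.sum_add_distrib, e1, e2, add_zero]
  have h1 : ∑ i, ∑ j, B i j * Q j i = ∑ i, ∑ j, B i j * Q i j := by
    rw [Finset.sum_comm]
    exact Finset.sum_congr rfl fun i _ => Finset.sum_congr rfl fun j _ => by rw [hB j i]
  simp only [← ha, mul_add, Finset.sum_add_distrib, h1] at h0
  linarith

/-- The second order expansion determines its matrix up to a matrix whose quadratic form vanishes on
the tangent space. -/
lemma HasTaylorTwo.inner_sub_eq_zero {A B : Matrix (Fin n) (Fin n) ℝ} (hB : HasTaylorTwo f θ B)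
    (hA : HasTaylorTwo f θ A) {e : EuclideanSpace ℝ (Fin n)}
    (he : ⟪(θ : EuclideanSpace ℝ (Fin n)), e⟫ = 0) :
    ⟪Matrix.toEuclideanLin (A - B) e, e⟫ = 0 := by
  refine eq_zero_of_isLittleO θ (q := fun h => ⟪Matrix.toEuclideanLin (A - B) h, h⟫) (m := 2)
    ?_ (fun c h => ?_) ?_ he
  · simp only [inner_toEuclideanLin]
    fun_prop
  · simp only [map_smul, inner_smul_left, inner_smul_right, conj_trivial]
    ring
  · refine ((hB.sub hA).const_mul_left 2).congr_left fun θ' => ?_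
    simp only [map_sub, LinearMap.sub_apply, inner_sub_left]
    ring

lemma HasTaylorTwo.hsNorm_sq_eq {A B : Matrix (Fin n) (Fin n) ℝ} (hB : HasTaylorTwo f θ B)
    (hsymm : ∀ i j, B i j = B j i)
    (hBθ : ∀ i, ∑ j, B i j * (θ : EuclideanSpace ℝ (Fin n)) j = 0) (hA : HasTaylorTwo f θ A) :
    hsNorm A ^ 2 = hsNorm B ^ 2 + hsNorm (A - B) ^ 2 := by
  have h := sum_mul_eq_zero hsymm hBθ fun e he => hB.inner_sub_eq_zero hA he
  have h2 : ∑ i, ∑ j, A i j ^ 2 = ∑ i, ∑ j, B i j ^ 2 + ∑ i, ∑ j, (A - B) i j ^ 2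
      + 2 * ∑ i, ∑ j, B i j * (A - B) i j := by
    simp only [Finset.mul_sum, ← Finset.sum_add_distrib, Matrix.sub_apply]
    exact Finset.sum_congr rfl fun i _ => Finset.sum_congr rfl fun j _ => by ring
  rw [hsNorm_sq, hsNorm_sq, hsNorm_sq, h2, h]
  ring

/-- A symmetric matrix annihilating the normal vector and satisfying the second order expansion is
the spherical second derivative. -/
lemma hessian_eq_of_tangent {B : Matrix (Fin n) (Fin n) ℝ} (hB : HasTaylorTwo f θ B)
    (hsymm : ∀ i j, B i j = B j i)
    (hBθ : ∀ i, ∑ j, B i j * (θ : EuclideanSpace ℝ (Fin n)) j = 0) : hessian f θ = B := by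
  have hex : ∃ B, IsHessian f θ B := by
    refine ⟨B, hB, fun A hA => ?_⟩
    have := hB.hsNorm_sq_eq hsymm hBθ hA
    exact le_of_sq_le_sq (by nlinarith [sq_nonneg (hsNorm (A - B))]) (Real.sqrt_nonneg _)
  rw [hessian, dif_pos hex]
  obtain ⟨h1, h2⟩ := hex.choose_spec
  have h3 := hB.hsNorm_sq_eq hsymm hBθ h1
  have h4 := pow_le_pow_left₀ (Real.sqrt_nonneg _) (h2 B hB) 2
  have h5 : ∑ i, ∑ j, (hex.choose - B) i j ^ 2 = 0 := by
    rw [← hsNorm_sq]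
    exact le_antisymm (by change hsNorm _ ^ 2 ≤ hsNorm _ ^ 2 at h4; linarith) (sq_nonneg _)
  ext i j
  have h6 := (Finset.sum_eq_zero_iff_of_nonneg
    (fun i _ => Finset.sum_nonneg fun j _ => sq_nonneg _)).1 h5 i (Finset.mem_univ i)
  have h7 := (Finset.sum_eq_zero_iff_of_nonneg (fun j _ => sq_nonneg _)).1 h6 j (Finset.mem_univ j)
  simpa [sub_eq_zero] using h7

/-- At a unit vector `x`, the Euclidean Hessian of a `0`-homogeneous function with its normal part
`-∇F ⊗ x - x ⊗ ∇F` removed. -/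
noncomputable def tangentHessian (F : EuclideanSpace ℝ (Fin n) → ℝ)
    (x : EuclideanSpace ℝ (Fin n)) : Matrix (Fin n) (Fin n) ℝ :=
  fun i j => pd i (pd j F) x + pd i F x * x j + x i * pd j F x

lemma sum_coe_sq (θ : UnitSphere n) :
    ∑ i, (θ : EuclideanSpace ℝ (Fin n)) i * (θ : EuclideanSpace ℝ (Fin n)) i = 1 := by
  have := EuclideanSpace.real_norm_sq_eq (θ : EuclideanSpace ℝ (Fin n))
  rw [norm_coe] at this
  simp only [← pow_two]
  linarith

/-- The normal part of the Euclidean Hessian contributes `⟨∇F, h⟩ ‖h‖ ^ 2` to the quadratic form at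
`h = θ' - θ`, because `⟨θ, h⟩ = -‖h‖ ^ 2 / 2`. This is `o(‖h‖ ^ 2)`. -/
lemma hasTaylorTwo_tangentHessian (hfF : ∀ θ : UnitSphere n, F θ = f θ) (hF : IsHomog 0 F)
    (hc : ContDiffAt ℝ 2 F (θ : EuclideanSpace ℝ (Fin n))) :
    HasTaylorTwo f θ (tangentHessian F θ) := by
  have h1 := (taylor_two hc).comp_tendsto (tendsto_coe θ)
  have h2 : (fun θ' : UnitSphere n => ⟪euclGrad F θ, (θ' : EuclideanSpace ℝ (Fin n)) - θ⟫
      * ‖(θ' : EuclideanSpace ℝ (Fin n)) - θ‖ ^ 2) =o[𝓝 θ]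
      fun θ' : UnitSphere n => 1 * ‖(θ' : EuclideanSpace ℝ (Fin n)) - θ‖ ^ 2 := by
    refine IsLittleO.mul_isBigO ?_ (isBigO_refl _ _)
    rw [isLittleO_one_iff]
    have : Continuous fun θ' : UnitSphere n =>
        ⟪euclGrad F θ, (θ' : EuclideanSpace ℝ (Fin n)) - θ⟫ := by fun_prop
    simpa using this.tendsto θ
  simp only [one_mul] at h2
  have h3 := h1.add (h2.const_mul_left (1 / 2))
  refine h3.congr_left fun θ' => ?_
  simp only [Function.comp_apply]
  rw [gradient_eq hfF hF (hc.differentiableAt (by norm_num)), hfF, hfF, inner_euclGrad]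
  set h := (θ' : EuclideanSpace ℝ (Fin n)) - θ with hh
  have hθ : ‖h‖ ^ 2 = -2 * ∑ i, (θ : EuclideanSpace ℝ (Fin n)) i * h i := by
    have := inner_sub_self θ θ'
    rw [← hh, PiLp.inner_apply] at this
    simp only [RCLike.inner_apply, conj_trivial, mul_comm (h _)] at this
    linarith
  have hquad : ⟪Matrix.toEuclideanLin (tangentHessian F θ) h, h⟫
      = fderiv ℝ (fderiv ℝ F) θ h h - fderiv ℝ F θ h * ‖h‖ ^ 2 := by
    have e1 : fderiv ℝ (fderiv ℝ F) θ h h = ∑ i, ∑ j, h i * (h j * pd i (pd j F) θ) := by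
      have := apply_eq_sum ((fderiv ℝ (fderiv ℝ F) θ).flip h) h
      simp only [ContinuousLinearMap.flip_apply] at this
      rw [this]
      refine Finset.sum_congr rfl fun i _ => ?_
      rw [apply_eq_sum _ h, Finset.mul_sum]
      simp only [fderiv_fderiv_single hc]
    have e2 : fderiv ℝ F θ h * ‖h‖ ^ 2
        = - (∑ i, ∑ j, h i * pd i F θ * ((θ : EuclideanSpace ℝ (Fin n)) j * h j)
          + ∑ i, ∑ j, (θ : EuclideanSpace ℝ (Fin n)) i * h i * (h j * pd j F θ)) := by
      rw [hθ, fderiv_apply_eq_sum, ← Finset.sum_mul_sum, ← Finset.sum_mul_sum]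
      ring
    rw [inner_toEuclideanLin, e1, e2, sub_neg_eq_add, ← add_assoc]
    simp only [← Finset.sum_add_distrib, tangentHessian]
    exact Finset.sum_congr rfl fun i _ => Finset.sum_congr rfl fun j _ => by ring
  rw [hquad]
  ring

/-- The spherical second derivative of a function is computed from the Euclidean derivatives of its
`0`-homogeneous extension. -/
lemma hessian_eq (hfF : ∀ θ : UnitSphere n, F θ = f θ) (hF : IsHomog 0 F)
    (hc : ContDiffAt ℝ 2 F (θ : EuclideanSpace ℝ (Fin n))) :
    hessian f θ = tangentHessian F θ := by
  refine hessian_eq_of_tangent (hasTaylorTwo_tangentHessian hfF hF hc) (fun i j => ?_) fun i => ?_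
  · simp only [tangentHessian, pd_comm hc i j]
    ring
  · have h1 := sum_mul_pd_pd hF hc i
    have h2 := sum_mul_pd hF (hc.differentiableAt (by norm_num))
    have h3 := sum_coe_sq θ
    have : ∑ j, tangentHessian F θ i j * (θ : EuclideanSpace ℝ (Fin n)) j
        = (∑ j, (θ : EuclideanSpace ℝ (Fin n)) j * pd i (pd j F) θ)
          + pd i F θ * (∑ j, (θ : EuclideanSpace ℝ (Fin n)) j * (θ : EuclideanSpace ℝ (Fin n)) j)
          + (θ : EuclideanSpace ℝ (Fin n)) i *
            ∑ j, (θ : EuclideanSpace ℝ (Fin n)) j * pd j F θ := by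
      simp only [Finset.mul_sum, ← Finset.sum_add_distrib, tangentHessian]
      exact Finset.sum_congr rfl fun j _ => by ring
    rw [this, h1, h2, h3]
    ring

lemma laplacian_eq (hfF : ∀ θ : UnitSphere n, F θ = f θ) (hF : IsHomog 0 F)
    (hc : ContDiffAt ℝ 2 F (θ : EuclideanSpace ℝ (Fin n))) :
    laplacian f θ = ∑ i, pd i (pd i F) θ := by
  have h2 := sum_mul_pd hF (hc.differentiableAt (by norm_num))
  rw [laplacian, hessian_eq hfF hF hc, Matrix.trace]
  have : ∑ i, (tangentHessian F θ).diag i = ∑ i, pd i (pd i F) θ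
      + 2 * ∑ i, (θ : EuclideanSpace ℝ (Fin n)) i * pd i F θ := by
    simp only [Finset.mul_sum, ← Finset.sum_add_distrib, tangentHessian, Matrix.diag]
    exact Finset.sum_congr rfl fun j _ => by ring
  rw [this, h2]
  ring

/-- The spherical second derivative has a smaller norm than the Euclidean Hessian of the
`0`-homogeneous extension: the mixed tangential-normal entries of the latter, which form the vector
`-∇F`, occur twice in its norm. -/
lemma hsNorm_hessian_sq (hfF : ∀ θ : UnitSphere n, F θ = f θ) (hF : IsHomog 0 F)
    (hc : ContDiffAt ℝ 2 F (θ : EuclideanSpace ℝ (Fin n))) :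
    hsNorm (hessian f θ) ^ 2
      = ∑ i, ∑ j, pd i (pd j F) θ * pd i (pd j F) θ - 2 * ∑ i, pd i F θ * pd i F θ := by
  have h1 := sum_mul_pd_pd hF hc
  have h2 := sum_mul_pd hF (hc.differentiableAt (by norm_num))
  have h3 := sum_coe_sq θ
  rw [hsNorm_sq, hessian_eq hfF hF hc]
  have key : ∀ i, ∑ j, tangentHessian F θ i j ^ 2 = ∑ j, pd i (pd j F) θ * pd i (pd j F) θ
      + pd i F θ * pd i F θ
        * ∑ j, (θ : EuclideanSpace ℝ (Fin n)) j * (θ : EuclideanSpace ℝ (Fin n)) j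
      + (θ : EuclideanSpace ℝ (Fin n)) i * (θ : EuclideanSpace ℝ (Fin n)) i
        * ∑ j, pd j F θ * pd j F θ
      + 2 * pd i F θ * ∑ j, (θ : EuclideanSpace ℝ (Fin n)) j * pd i (pd j F) θ
      + 2 * (θ : EuclideanSpace ℝ (Fin n)) i * ∑ j, pd j F θ * pd i (pd j F) θ
      + 2 * (θ : EuclideanSpace ℝ (Fin n)) i * pd i F θ
        * ∑ j, (θ : EuclideanSpace ℝ (Fin n)) j * pd j F θ := by
    intro i
    simp only [Finset.mul_sum, ← Finset.sum_add_distrib, tangentHessian]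
    exact Finset.sum_congr rfl fun j _ => by ring
  have h4 : ∑ i, 2 * (θ : EuclideanSpace ℝ (Fin n)) i * ∑ j, pd j F θ * pd i (pd j F) θ
      = -2 * ∑ j, pd j F θ * pd j F θ := by
    simp only [Finset.mul_sum]
    rw [Finset.sum_comm]
    refine Finset.sum_congr rfl fun j _ => ?_
    have := congrArg (fun s => 2 * pd j F θ * s) (h1 j)
    simp only [Finset.mul_sum] at this
    rw [show -2 * (pd j F θ * pd j F θ) = 2 * pd j F θ * -pd j F θ by ring, ← this]
    exact Finset.sum_congr rfl fun i _ => by rw [pd_comm hc i j]; ring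
  simp only [key, h1, h2, h3, mul_zero, mul_one, add_zero, Finset.sum_add_distrib, h4,
    ← Finset.sum_mul, one_mul]
  have h5 : ∑ i, 2 * pd i F θ * -pd i F θ = -2 * ∑ i, pd i F θ * pd i F θ := by
    rw [Finset.mul_sum]
    exact Finset.sum_congr rfl fun i _ => by ring
  rw [h5]
  ring

end UnitSphere

/-! ### The divergence theorem on the sphere -/

/-- Integration in polar coordinates of a product of a radial and an angular function. -/
lemma integral_norm_mul_angular {E : Type*} [NormedAddCommGroup E] [NormedSpace ℝ E]
    [FiniteDimensional ℝ E] [Nontrivial E] [MeasurableSpace E] [BorelSpace E] (μ : Measure E)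
    [μ.IsAddHaarMeasure] (ψ : ℝ → ℝ) (H : E → ℝ) :
    ∫ x, H (‖x‖⁻¹ • x) * ψ ‖x‖ ∂μ = (∫ θ : Metric.sphere (0 : E) 1, H θ ∂μ.toSphere)
      * ∫ r : Set.Ioi (0 : ℝ), ψ r ∂(Measure.volumeIoiPow (Module.finrank ℝ E - 1)) := by
  calc ∫ x, H (‖x‖⁻¹ • x) * ψ ‖x‖ ∂μ
      = ∫ x : ({(0)}ᶜ : Set E), H (‖x.1‖⁻¹ • x.1) * ψ ‖x.1‖ ∂(μ.comap (↑)) := by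
        rw [integral_subtype_comap (measurableSet_singleton _).compl
          fun x => H (‖x‖⁻¹ • x) * ψ ‖x‖, restrict_compl_singleton]
    _ = ∫ p, H p.1 * ψ p.2 ∂(μ.toSphere.prod (Measure.volumeIoiPow (Module.finrank ℝ E - 1))) := by
        simpa using μ.measurePreserving_homeomorphUnitSphereProd.integral_comp
          (Homeomorph.measurableEmbedding _)
          (fun p : Metric.sphere (0 : E) 1 × Set.Ioi (0 : ℝ) => H p.1 * ψ p.2)
    _ = _ := integral_prod_mul (fun θ : Metric.sphere (0 : E) 1 => H θ)
        (fun r : Set.Ioi (0 : ℝ) => ψ r)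

namespace EuclideanCalculus

variable {n : ℕ}

lemma continuous_pd {u : EuclideanSpace ℝ (Fin n) → ℝ} (hu : ContDiff ℝ 1 u) (i : Fin n) :
    Continuous (pd i u) :=
  (hu.continuous_fderiv (by norm_num)).clm_apply continuous_const

lemma integrable_pd {u : EuclideanSpace ℝ (Fin n) → ℝ} (hu : ContDiff ℝ 1 u)
    (hs : HasCompactSupport u) (i : Fin n) : Integrable (pd i u) :=
  (continuous_pd hu i).integrable_of_hasCompactSupport (hs.fderiv_apply ℝ _)

lemma integral_pd_eq_zero {u : EuclideanSpace ℝ (Fin n) → ℝ} (hu : ContDiff ℝ 1 u)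
    (hs : HasCompactSupport u) (i : Fin n) : ∫ x, pd i u x = 0 := by
  have h := integral_mul_fderiv_eq_neg_fderiv_mul_of_integrable (μ := volume)
    (f := fun _ : EuclideanSpace ℝ (Fin n) => (1 : ℝ)) (g := u)
    (v := EuclideanSpace.single i (1 : ℝ)) (by simp) (by simpa using! integrable_pd hu hs i)
    (by simpa using hu.continuous.integrable_of_hasCompactSupport hs)
    (fun _ _ => differentiableAt_const _)
    (fun x _ => (hu.differentiable (by norm_num)).differentiableAt)
  simpa [pd] using h

/-- A smooth radial cutoff function, supported in the shell `1 ≤ ‖x‖ ^ 2 ≤ 3`, as a function of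
`‖x‖ ^ 2`. -/
noncomputable def shellBump : ContDiffBump (2 : ℝ) := ⟨1 / 2, 1, by norm_num, by norm_num⟩

lemma shellBump_eq_zero {s : ℝ} (hs : s ≤ 1 ∨ 3 ≤ s) : shellBump s = 0 := by
  refine shellBump.zero_of_le_dist ?_
  rw [Real.dist_eq]
  change 1 ≤ |s - 2|
  rcases hs with h | h
  · rw [abs_of_nonpos (by linarith)]; linarith
  · rw [abs_of_nonneg (by linarith)]; linarith

lemma eventually_shellBump_eq_zero :
    ∀ᶠ x : EuclideanSpace ℝ (Fin n) in 𝓝 0, shellBump (‖x‖ ^ 2) = 0 := by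
  filter_upwards [Metric.ball_mem_nhds (0 : EuclideanSpace ℝ (Fin n)) one_pos] with x hx
  refine shellBump_eq_zero (Or.inl ?_)
  rw [mem_ball_zero_iff] at hx
  exact pow_le_one₀ (norm_nonneg _) hx.le

lemma hasCompactSupport_shellBump_mul (u : EuclideanSpace ℝ (Fin n) → ℝ) :
    HasCompactSupport fun x => shellBump (‖x‖ ^ 2) * u x := by
  refine HasCompactSupport.intro (isCompact_closedBall (0 : EuclideanSpace ℝ (Fin n)) 2)
    fun x hx => ?_
  rw [mem_closedBall_zero_iff, not_le] at hx
  rw [shellBump_eq_zero (Or.inr (by nlinarith)), zero_mul]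

lemma contDiff_shellBump_mul {u : EuclideanSpace ℝ (Fin n) → ℝ} {m : ℕ} (hu : SmoothOff m u) :
    ContDiff ℝ m fun x => shellBump (‖x‖ ^ 2) * u x := by
  rw [contDiff_iff_contDiffAt]
  intro x
  rcases eq_or_ne x 0 with rfl | hx
  · refine (contDiffAt_const (c := (0 : ℝ))).congr_of_eventuallyEq ?_
    filter_upwards [eventually_shellBump_eq_zero] with y hy
    rw [hy, zero_mul]
  · exact (shellBump.contDiff.comp (contDiff_norm_sq ℝ)).contDiffAt.mul (hu x hx)

lemma pd_shellBump {x : EuclideanSpace ℝ (Fin n)} (i : Fin n) :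
    pd i (fun y => shellBump (‖y‖ ^ 2)) x = deriv shellBump (‖x‖ ^ 2) * (2 * x i) := by
  have h1 : HasDerivAt shellBump (deriv shellBump (‖x‖ ^ 2)) (‖x‖ ^ 2) :=
    (shellBump.contDiff.differentiable (n := 1) (by norm_num)).differentiableAt.hasDerivAt
  have h2 := h1.comp_hasFDerivAt x (hasStrictFDerivAt_norm_sq x).hasFDerivAt
  rw [pd, (show HasFDerivAt (fun y => shellBump (‖y‖ ^ 2)) _ x from h2).fderiv]
  simp [EuclideanSpace.inner_single_right]

lemma smoothOff_norm_zpow {m : ℕ} (k : ℤ) :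
    SmoothOff m (fun x : EuclideanSpace ℝ (Fin n) => ‖x‖ ^ k) := by
  intro x hx
  have h1 : ContDiffAt ℝ m (fun x : EuclideanSpace ℝ (Fin n) => ‖x‖) x := contDiffAt_norm ℝ hx
  cases k with
  | ofNat k => simpa using h1.pow k
  | negSucc k =>
    simp only [zpow_negSucc]
    exact (h1.pow (k + 1)).inv (pow_ne_zero _ (norm_ne_zero_iff.2 hx))

/-- **Divergence theorem on the sphere.** The divergence of a tangent field has integral zero,
provided that it is homogeneous: multiplied by a radial cutoff function it remains a divergence,
since the field is tangent, and polar coordinates isolate the integral over the sphere. -/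
theorem integral_sphere_divergence [Nontrivial (EuclideanSpace ℝ (Fin n))]
    {V : Fin n → EuclideanSpace ℝ (Fin n) → ℝ} {D : EuclideanSpace ℝ (Fin n) → ℝ} {k : ℤ}
    (hV : ∀ i, SmoothOff 1 (V i)) (htan : ∀ x, x ≠ 0 → ∑ i, x i * V i x = 0)
    (hD : ∀ x, x ≠ 0 → ∑ i, pd i (V i) x = D x) (hk : IsHomog k D) :
    ∫ θ : UnitSphere n, D θ ∂(volume : Measure (EuclideanSpace ℝ (Fin n))).toSphere = 0 := by
  let U : Fin n → EuclideanSpace ℝ (Fin n) → ℝ := fun i x => shellBump (‖x‖ ^ 2) * V i x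
  have hU : ∀ i, ContDiff ℝ 1 (U i) := fun i => contDiff_shellBump_mul (hV i)
  have hUs : ∀ i, HasCompactSupport (U i) := fun i => hasCompactSupport_shellBump_mul (V i)
  let ψ : ℝ → ℝ := fun r => shellBump (r ^ 2) * r ^ k
  have hpt : ∀ x, ∑ i, pd i (U i) x = D (‖x‖⁻¹ • x) * ψ ‖x‖ := by
    intro x
    rcases eq_or_ne x 0 with rfl | hx
    · have : ∀ i, pd i (U i) 0 = 0 := by
        intro i
        have h0 : U i =ᶠ[𝓝 0] fun _ => 0 := by
          filter_upwards [eventually_shellBump_eq_zero] with y hy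
          simp [U, hy]
        rw [pd_congr i h0]
        simp [pd]
      simp [this, ψ, shellBump_eq_zero]
    · have hb : DifferentiableAt ℝ
          (fun y : EuclideanSpace ℝ (Fin n) => shellBump (‖y‖ ^ 2)) x :=
        ((shellBump.contDiff (n := 1)).comp (contDiff_norm_sq ℝ)).contDiffAt.differentiableAt
          (by norm_num)
      have h1 : ∀ i, pd i (U i) x = shellBump (‖x‖ ^ 2) * pd i (V i) x
          + 2 * deriv shellBump (‖x‖ ^ 2) * (x i * V i x) := by
        intro i
        rw [pd_mul i hb ((hV i).differentiableAt one_ne_zero hx), pd_shellBump]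
        ring
      have h2 : D x = ‖x‖ ^ k * D (‖x‖⁻¹ • x) := by
        rw [← hk _ (norm_pos_iff.2 hx), smul_smul, mul_inv_cancel₀ (norm_ne_zero_iff.2 hx),
          one_smul]
      simp only [h1, Finset.sum_add_distrib, ← Finset.mul_sum, htan x hx, hD x hx, ψ]
      rw [h2]
      ring
  have hzero : ∫ x, D (‖x‖⁻¹ • x) * ψ ‖x‖ = 0 := by
    simp only [← hpt]
    rw [integral_finsetSum _ fun i _ => integrable_pd (hU i) (hUs i) i]
    exact Finset.sum_eq_zero fun i _ => integral_pd_eq_zero (hU i) (hUs i) i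
  have hpos : 0 < ∫ x : EuclideanSpace ℝ (Fin n), ψ ‖x‖ := by
    have hcont : Continuous fun x : EuclideanSpace ℝ (Fin n) => ψ ‖x‖ :=
      (contDiff_shellBump_mul (m := 0) (smoothOff_norm_zpow k)).continuous
    refine hcont.integral_pos_of_hasCompactSupport_nonneg_nonzero
      (hasCompactSupport_shellBump_mul _)
      (fun x => mul_nonneg shellBump.nonneg (zpow_nonneg (norm_nonneg _) _))
      (x := ?_) ?_
    · exact (exists_norm_eq (EuclideanSpace ℝ (Fin n)) (Real.sqrt_nonneg 2)).choose
    · rw [(exists_norm_eq (EuclideanSpace ℝ (Fin n)) (Real.sqrt_nonneg 2)).choose_spec]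
      have h1 : shellBump 2 = 1 := 
        shellBump.one_of_mem_closedBall (Metric.mem_closedBall_self (by norm_num [shellBump]))
      simp only [ψ]
      rw [Real.sq_sqrt (by norm_num), h1]
      positivity
  rw [integral_norm_mul_angular] at hzero
  have hpos' := integral_norm_mul_angular (volume : Measure (EuclideanSpace ℝ (Fin n))) ψ
    (fun _ => 1)
  simp only [one_mul] at hpos'
  rw [hpos'] at hpos
  refine (mul_eq_zero.1 hzero).resolve_right fun h => ?_
  rw [h, mul_zero] at hpos
  exact lt_irrefl _ hpos

end EuclideanCalculus

/-! ### Green's and Bochner's formulas for homogeneous functions -/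

namespace EuclideanCalculus

variable {n : ℕ}

lemma SmoothOff.continuous_sphere {u : EuclideanSpace ℝ (Fin n) → ℝ} {m : ℕ}
    (hu : SmoothOff m u) : Continuous fun θ : UnitSphere n => u θ :=
  continuous_iff_continuousAt.2 fun θ =>
    ((hu θ (UnitSphere.coe_ne_zero θ)).continuousAt).comp continuous_subtype_val.continuousAt

lemma SmoothOff.integrable_sphere {u : EuclideanSpace ℝ (Fin n) → ℝ} {m : ℕ}
    (hu : SmoothOff m u) :
    Integrable (fun θ : UnitSphere n => u θ)
      (volume : Measure (EuclideanSpace ℝ (Fin n))).toSphere :=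
  hu.continuous_sphere.integrable_of_hasCompactSupport (HasCompactSupport.of_compactSpace _)

/-- The Euclidean Laplacian. -/
noncomputable def lap (u : EuclideanSpace ℝ (Fin n) → ℝ) (x : EuclideanSpace ℝ (Fin n)) : ℝ :=
  ∑ i, pd i (pd i u) x

/-- The inner product `⟨∇u, ∇v⟩` of the Euclidean gradients. -/
noncomputable def gradDot (u v : EuclideanSpace ℝ (Fin n) → ℝ) (x : EuclideanSpace ℝ (Fin n)) :
    ℝ :=
  ∑ i, pd i u x * pd i v x

/-- The squared Hilbert-Schmidt norm of the Euclidean Hessian. -/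
noncomputable def hessSq (u : EuclideanSpace ℝ (Fin n) → ℝ) (x : EuclideanSpace ℝ (Fin n)) : ℝ :=
  ∑ i, ∑ j, pd i (pd j u) x * pd i (pd j u) x

variable {u v : EuclideanSpace ℝ (Fin n) → ℝ}

lemma SmoothOff.lap {m : ℕ} (hu : SmoothOff (m + 2) u) : SmoothOff m (lap u) :=
  SmoothOff.sum fun i => (hu.pd i).pd i

lemma SmoothOff.gradDot {m : ℕ} (hu : SmoothOff (m + 1) u) (hv : SmoothOff (m + 1) v) :
    SmoothOff m (gradDot u v) :=
  SmoothOff.sum fun i => (hu.pd i).mul (hv.pd i)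

lemma SmoothOff.hessSq {m : ℕ} (hu : SmoothOff (m + 2) u) : SmoothOff m (hessSq u) :=
  SmoothOff.sum fun i => SmoothOff.sum fun j => ((hu.pd j).pd i).mul ((hu.pd j).pd i)

lemma IsHomog.lap (hu : IsHomog 0 u) : IsHomog (-2) (lap u) :=
  IsHomog.sum fun i => (hu.pd i).pd i

lemma IsHomog.gradDot (hu : IsHomog 0 u) (hv : IsHomog 0 v) : IsHomog (-2) (gradDot u v) :=
  IsHomog.sum fun i => (hu.pd i).mul (hv.pd i)

lemma IsHomog.hessSq (hu : IsHomog 0 u) : IsHomog (-4) (hessSq u) :=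
  IsHomog.sum fun i => IsHomog.sum fun j => ((hu.pd j).pd i).mul ((hu.pd j).pd i)

/-- Green's formula on the sphere. -/
lemma integral_mul_lap [Nontrivial (EuclideanSpace ℝ (Fin n))] (hu : IsHomog 0 u)
    (hv : IsHomog 0 v) (hu2 : SmoothOff 2 u) (hv2 : SmoothOff 2 v) :
    ∫ θ : UnitSphere n, u θ * lap v θ ∂(volume : Measure (EuclideanSpace ℝ (Fin n))).toSphere
      = -∫ θ : UnitSphere n, gradDot u v θ
          ∂(volume : Measure (EuclideanSpace ℝ (Fin n))).toSphere := by
  have hu1 : SmoothOff 1 u := hu2.of_le (by norm_num)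
  have h := integral_sphere_divergence (V := fun i x => u x * pd i v x)
    (D := fun x => u x * lap v x + gradDot u v x) (k := -2)
    (fun i => hu1.mul (hv2.pd i)) (fun x hx => ?_) (fun x hx => ?_)
    (IsHomog.add (by simpa using hu.mul hv.lap) (hu.gradDot hv))
  · rw [integral_add (hu2.of_le (Nat.zero_le 2) |>.mul hv2.lap).integrable_sphere
      ((hu2.of_le one_le_two).gradDot (m := 0) (hv2.of_le one_le_two)).integrable_sphere] at h
    linarith
  · have := congrArg (fun s => u x * s)
      (sum_mul_pd hv (hv2.differentiableAt two_ne_zero hx))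
    simp only [Finset.mul_sum, mul_zero] at this
    rw [← this]
    exact Finset.sum_congr rfl fun i _ => by ring
  · simp only [lap, gradDot, Finset.mul_sum, ← Finset.sum_add_distrib]
    refine Finset.sum_congr rfl fun i _ => ?_
    rw [pd_mul i (hu1.differentiableAt one_ne_zero hx)
      ((hv2.pd (m := 1) i).differentiableAt one_ne_zero hx)]
    ring

lemma pd_pd_pd_comm {x : EuclideanSpace ℝ (Fin n)} (hu : ContDiffAt ℝ 3 u x) (i j : Fin n) :
    pd j (pd j (pd i u)) x = pd i (pd j (pd j u)) x := by
  have h1 : pd j (pd i u) =ᶠ[𝓝 x] pd i (pd j u) := by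
    filter_upwards [hu.eventually (by simp)] with y hy
    exact pd_comm (hy.of_le (by norm_num)) j i
  rw [pd_congr j h1]
  exact pd_comm (contDiffAt_pd (m := 2) j hu) j i

/-- The tangent vector field whose divergence yields Bochner's formula. It is the tangential part
of `ΔF ∇F - D²F ∇F`, scaled by `‖x‖ ^ 2`. -/
noncomputable def bochnerField (u : EuclideanSpace ℝ (Fin n) → ℝ) (i : Fin n)
    (x : EuclideanSpace ℝ (Fin n)) : ℝ :=
  ‖x‖ ^ 2 * (lap u x * pd i u x - ∑ j, pd i (pd j u) x * pd j u x) - x i * gradDot u u x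

lemma sum_mul_sum_pd_pd {x : EuclideanSpace ℝ (Fin n)} (hu : IsHomog 0 u)
    (hc : ContDiffAt ℝ 2 u x) :
    ∑ i, x i * ∑ j, pd i (pd j u) x * pd j u x = - gradDot u u x := by
  simp only [Finset.mul_sum, gradDot, ← Finset.sum_neg_distrib]
  rw [Finset.sum_comm]
  refine Finset.sum_congr rfl fun j _ => ?_
  have := congrArg (fun s => s * pd j u x) (sum_mul_pd_pd hu hc j)
  simp only [Finset.sum_mul] at this
  rw [← neg_mul, ← this]
  exact Finset.sum_congr rfl fun i _ => by rw [pd_comm hc i j]; ring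

lemma sum_mul_bochnerField {x : EuclideanSpace ℝ (Fin n)} (hu : IsHomog 0 u)
    (hc : ContDiffAt ℝ 2 u x) : ∑ i, x i * bochnerField u i x = 0 := by
  have h1 := sum_mul_pd hu (hc.differentiableAt (by norm_num))
  have h2 := sum_mul_sum_pd_pd hu hc
  have h3 : ∑ i, x i * x i = ‖x‖ ^ 2 := by
    rw [EuclideanSpace.real_norm_sq_eq]
    simp only [pow_two]
  have : ∑ i, x i * bochnerField u i x = ‖x‖ ^ 2 * (lap u x * ∑ i, x i * pd i u x
      - ∑ i, x i * ∑ j, pd i (pd j u) x * pd j u x) - (∑ i, x i * x i) * gradDot u u x := by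
    rw [Finset.mul_sum (a := lap u x), ← Finset.sum_sub_distrib, Finset.mul_sum, Finset.sum_mul,
      ← Finset.sum_sub_distrib]
    exact Finset.sum_congr rfl fun i _ => by rw [bochnerField]; ring
  rw [this, h1, h2, h3]
  ring

lemma smoothOff_bochnerField (hu : SmoothOff 3 u) (i : Fin n) : SmoothOff 1 (bochnerField u i) := by
  have h1 : ∀ i, SmoothOff 1 (pd i u) := fun i => (hu.of_le (by norm_num) : SmoothOff 2 u).pd i
  exact (smoothOff_norm_sq.mul ((hu.lap.mul (h1 i)).sub
    (SmoothOff.sum fun j => ((hu.pd j).pd i).mul (h1 j)))).sub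
    ((smoothOff_coord i).mul ((hu.of_le (by norm_num) : SmoothOff 2 u).gradDot
      (hu.of_le (by norm_num))))

lemma sum_pd_bochnerField {x : EuclideanSpace ℝ (Fin n)} (hx : x ≠ 0) (hu : IsHomog 0 u)
    (hs : SmoothOff 3 u) :
    ∑ i, pd i (bochnerField u i) x
      = ‖x‖ ^ 2 * (lap u x * lap u x - hessSq u x) - ((n : ℝ) - 4) * gradDot u u x := by
  have hs2 : SmoothOff 2 u := hs.of_le (by norm_num)
  have d1 : ∀ i, DifferentiableAt ℝ (pd i u) x :=
    fun i => (hs2.pd (m := 1) i).differentiableAt one_ne_zero hx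
  have d2 : ∀ i j, DifferentiableAt ℝ (pd i (pd j u)) x :=
    fun i j => ((hs.pd j).pd (m := 1) i).differentiableAt one_ne_zero hx
  have dl : DifferentiableAt ℝ (lap u) x := (hs.lap (m := 1)).differentiableAt one_ne_zero hx
  have dg : DifferentiableAt ℝ (gradDot u u) x :=
    (hs2.gradDot (m := 1) hs2).differentiableAt one_ne_zero hx
  have dn : DifferentiableAt ℝ (fun y : EuclideanSpace ℝ (Fin n) => ‖y‖ ^ 2) x :=
    (smoothOff_norm_sq (m := 1)).differentiableAt one_ne_zero hx
  have dc : ∀ i : Fin n, DifferentiableAt ℝ (fun y : EuclideanSpace ℝ (Fin n) => y i) x :=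
    fun i => (smoothOff_coord (m := 1) i).differentiableAt one_ne_zero hx
  have dm : ∀ i j, DifferentiableAt ℝ (fun y => pd i (pd j u) y * pd j u y) x :=
    fun i j => (d2 i j).mul (d1 j)
  have ds : ∀ i, DifferentiableAt ℝ (fun y => ∑ j, pd i (pd j u) y * pd j u y) x :=
    fun i => DifferentiableAt.fun_sum fun j _ => dm i j
  have dt : ∀ i, DifferentiableAt ℝ
      (fun y => lap u y * pd i u y - ∑ j, pd i (pd j u) y * pd j u y) x :=
    fun i => (dl.mul (d1 i)).sub (ds i)
  have hpl : ∀ i, pd i (lap u) x = ∑ j, pd i (pd j (pd j u)) x :=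
    fun i => pd_sum i _ fun j _ => d2 j j
  have hpg : ∀ i, pd i (gradDot u u) x = 2 * ∑ j, pd i (pd j u) x * pd j u x := by
    intro i
    rw [Finset.mul_sum]
    refine (pd_sum i _ fun j _ => (d1 j).fun_mul (d1 j)).trans (Finset.sum_congr rfl fun j _ => ?_)
    rw [pd_mul i (d1 j) (d1 j)]
    ring
  have hps : ∀ i, pd i (fun y => ∑ j, pd i (pd j u) y * pd j u y) x
      = ∑ j, pd i (pd i (pd j u)) x * pd j u x + ∑ j, pd i (pd j u) x * pd i (pd j u) x := by
    intro i
    rw [pd_sum i _ fun j _ => dm i j, ← Finset.sum_add_distrib]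
    refine Finset.sum_congr rfl fun j _ => ?_
    rw [pd_mul i (d2 i j) (d1 j)]
    ring
  have hpd : ∀ i, pd i (bochnerField u i) x =
      2 * (lap u x * (x i * pd i u x) - x i * ∑ j, pd i (pd j u) x * pd j u x)
      + ‖x‖ ^ 2 * ((∑ j, pd i (pd j (pd j u)) x) * pd i u x + lap u x * pd i (pd i u) x
        - (∑ j, pd i (pd i (pd j u)) x * pd j u x + ∑ j, pd i (pd j u) x * pd i (pd j u) x))
      - gradDot u u x - 2 * (x i * ∑ j, pd i (pd j u) x * pd j u x) := by
    intro i
    have e1 : pd i (bochnerField u i) x = _ :=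
      pd_sub i (dn.mul (dt i)) ((dc i).mul dg)
    rw [e1, pd_mul i (dc i) dg, pd_mul i dn (dt i), pd_norm_sq, pd_coord,
      pd_sub i (dl.fun_mul (d1 i)) (ds i), pd_mul i dl (d1 i), hpl, hps, hpg, if_pos rfl]
    ring
  have h1 := sum_mul_pd hu (hs.differentiableAt (by norm_num) hx)
  have h2 := sum_mul_sum_pd_pd hu (hs2 x hx)
  -- The terms of third order cancel.
  have h3 : ∑ i, ∑ j, pd i (pd i (pd j u)) x * pd j u x
      = ∑ i, (∑ j, pd i (pd j (pd j u)) x) * pd i u x := by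
    simp only [Finset.sum_mul]
    rw [Finset.sum_comm]
    exact Finset.sum_congr rfl fun i _ => Finset.sum_congr rfl fun j _ => by
      rw [pd_pd_pd_comm (hs x hx) i j]
  simp only [hpd, Finset.sum_sub_distrib, Finset.sum_add_distrib, ← Finset.mul_sum, h1, h2, h3,
    Finset.sum_const, Finset.card_univ, Fintype.card_fin, nsmul_eq_mul]
  change _ = ‖x‖ ^ 2 * (lap u x * (∑ i, pd i (pd i u) x) - ∑ i, ∑ j, _) - _
  ring

/-- Bochner's formula on the sphere, in terms of the Euclidean derivatives of a `0`-homogeneous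
function. -/
lemma integral_lap_sq [Nontrivial (EuclideanSpace ℝ (Fin n))] (hu : IsHomog 0 u)
    (hs : SmoothOff 3 u) :
    ∫ θ : UnitSphere n, lap u θ * lap u θ ∂(volume : Measure (EuclideanSpace ℝ (Fin n))).toSphere
      = ∫ θ : UnitSphere n, hessSq u θ ∂(volume : Measure (EuclideanSpace ℝ (Fin n))).toSphere
        + ((n : ℝ) - 4) * ∫ θ : UnitSphere n, gradDot u u θ
          ∂(volume : Measure (EuclideanSpace ℝ (Fin n))).toSphere := by
  have hs2 : SmoothOff 2 u := hs.of_le (by norm_num)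
  have hom : IsHomog (-2) fun x => ‖x‖ ^ 2 * (lap u x * lap u x - hessSq u x) :=
    isHomog_norm_sq.mul ((hu.lap.mul hu.lap).sub hu.hessSq)
  have h := integral_sphere_divergence (V := bochnerField u) (k := -2)
    (smoothOff_bochnerField hs) (fun x hx => sum_mul_bochnerField hu (hs2 x hx))
    (fun x hx => sum_pd_bochnerField hx hu hs)
    (hom.sub ((hu.gradDot hu).const_mul _))
  have i1 := ((hs.lap (m := 1)).mul hs.lap).integrable_sphere
  have i2 := (hs.hessSq (m := 1)).integrable_sphere
  have i3 := (hs2.gradDot (m := 1) hs2).integrable_sphere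
  simp only [UnitSphere.norm_coe, one_pow, one_mul] at h
  rw [integral_sub (by exact i1.sub i2) (i3.const_mul _), integral_sub i1 i2,
    integral_const_mul] at h
  linarith

end EuclideanCalculus

/-! ### The homogeneous extension of a function on the sphere -/

namespace UnitSphere

open EuclideanCalculus

variable {n : ℕ}

lemma normalize_mem {x : EuclideanSpace ℝ (Fin n)} (hx : x ≠ 0) :
    ‖x‖⁻¹ • x ∈ Metric.sphere (0 : EuclideanSpace ℝ (Fin n)) 1 := by
  rw [mem_sphere_zero_iff_norm, norm_smul, norm_inv, norm_norm,
    inv_mul_cancel₀ (norm_ne_zero_iff.2 hx)]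

open Classical in
/-- The `0`-homogeneous extension `x ↦ f (x / ‖x‖)`, with value `0` at the origin. -/
noncomputable def homogExtension (f : UnitSphere n → ℝ) (x : EuclideanSpace ℝ (Fin n)) : ℝ :=
  if hx : x ≠ 0 then f ⟨‖x‖⁻¹ • x, normalize_mem hx⟩ else 0

lemma homogExtension_coe (f : UnitSphere n → ℝ) (θ : UnitSphere n) : homogExtension f θ = f θ := by
  rw [homogExtension, dif_pos (coe_ne_zero θ)]
  congr 1
  ext1
  simp

lemma isHomog_homogExtension (f : UnitSphere n → ℝ) : IsHomog 0 (homogExtension f) := by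
  intro t ht x
  rcases eq_or_ne x 0 with rfl | hx
  · simp
  · rw [homogExtension, homogExtension, dif_pos hx, dif_pos (smul_ne_zero ht.ne' hx), zpow_zero,
      one_mul]
    congr 2
    rw [norm_smul, Real.norm_of_nonneg ht.le, smul_smul]
    congr 1
    field_simp

lemma smoothOff_homogExtension [Fact (2 ≤ n)] {m : ℕ} {f : UnitSphere n → ℝ}
    (hf : ContMDiff (𝓡 (n - 1)) 𝓘(ℝ, ℝ) m f) : SmoothOff m (homogExtension f) := by
  let U : TopologicalSpace.Opens (EuclideanSpace ℝ (Fin n)) := ⟨{0}ᶜ, isOpen_compl_singleton⟩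
  have h1 : ContMDiff 𝓘(ℝ, EuclideanSpace ℝ (Fin n)) 𝓘(ℝ, EuclideanSpace ℝ (Fin n)) m
      (fun x : U => ‖(x : EuclideanSpace ℝ (Fin n))‖⁻¹ • (x : EuclideanSpace ℝ (Fin n))) := by
    intro x
    refine contMDiffAt_subtype_iff (f := fun x : EuclideanSpace ℝ (Fin n) => ‖x‖⁻¹ • x) |>.2 ?_
    have hx : (x : EuclideanSpace ℝ (Fin n)) ≠ 0 := x.2
    exact (((contDiffAt_norm ℝ hx).inv (norm_ne_zero_iff.2 hx)).smul contDiffAt_id).contMDiffAt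
  have h2 := hf.comp (h1.codRestrict_sphere (n := n - 1) fun x => normalize_mem x.2)
  intro x hx
  have h3 := contMDiffAt_subtype_iff (U := U) (f := homogExtension f) (x := ⟨x, hx⟩) |>.1
    ((h2 ⟨x, hx⟩).congr_of_eventuallyEq (Eventually.of_forall fun y => ?_))
  · exact h3.contDiffAt
  · have hy : (y : EuclideanSpace ℝ (Fin n)) ≠ 0 := y.2
    exact dif_pos hy

end UnitSphere

/-! ### The integral identity -/

open EuclideanCalculus

/-- The integrated Bochner-type identity for `C⁴` functions on the unit sphere `S^{n-1}`, `n ≥ 2`.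
Both integrands are also asserted to be integrable, so that no integral is a default value. -/
theorem proposition4p1 (n : ℕ) [Fact (2 ≤ n)] (f : UnitSphere n → ℝ)
    (hf : ContMDiff (𝓡 (n - 1)) 𝓘(ℝ, ℝ) 4 f) :
    Integrable (fun θ => UnitSphere.hsNorm (UnitSphere.hessian f θ) ^ 2) (UnitSphere.sigma n) ∧
    Integrable (fun θ => f θ * (UnitSphere.laplacian (UnitSphere.laplacian f) θ
      + ((n : ℝ) - 2) * UnitSphere.laplacian f θ)) (UnitSphere.sigma n) ∧
    ∫ θ, UnitSphere.hsNorm (UnitSphere.hessian f θ) ^ 2 ∂(UnitSphere.sigma n) =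
      ∫ θ, f θ * (UnitSphere.laplacian (UnitSphere.laplacian f) θ
        + ((n : ℝ) - 2) * UnitSphere.laplacian f θ) ∂(UnitSphere.sigma n) := by
  have hn : 2 ≤ n := Fact.out
  have : Nontrivial (EuclideanSpace ℝ (Fin n)) :=
    Module.nontrivial_of_finrank_pos (R := ℝ) (by rw [finrank_euclideanSpace_fin]; omega)
  set F := UnitSphere.homogExtension f
  have hfF : ∀ θ : UnitSphere n, F θ = f θ := UnitSphere.homogExtension_coe f
  have hF : IsHomog 0 F := UnitSphere.isHomog_homogExtension f
  have hF4 : SmoothOff 4 F := UnitSphere.smoothOff_homogExtension hf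
  have hF2 : SmoothOff 2 F := hF4.of_le (by norm_num)
  -- The factor `‖x‖ ^ 2` turns `ΔF` into the `0`-homogeneous extension of the spherical Laplacian.
  let G : EuclideanSpace ℝ (Fin n) → ℝ := fun x => ‖x‖ ^ 2 * lap F x
  have hG : IsHomog 0 G := by simpa using isHomog_norm_sq.mul hF.lap
  have hG2 : SmoothOff 2 G := smoothOff_norm_sq.mul hF4.lap
  have hGθ : ∀ θ : UnitSphere n, G θ = lap F θ := fun θ => by simp [G]
  have hlap : ∀ θ, UnitSphere.laplacian f θ = lap F θ :=
    fun θ => UnitSphere.laplacian_eq hfF hF (hF2 θ (UnitSphere.coe_ne_zero θ))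
  have hlap2 : ∀ θ, UnitSphere.laplacian (UnitSphere.laplacian f) θ = lap G θ :=
    fun θ => UnitSphere.laplacian_eq (fun θ => (hGθ θ).trans (hlap θ).symm) hG
      (hG2 θ (UnitSphere.coe_ne_zero θ))
  have hL : (fun θ => UnitSphere.hsNorm (UnitSphere.hessian f θ) ^ 2)
      = fun θ : UnitSphere n => hessSq F θ - 2 * gradDot F F θ :=
    funext fun θ => UnitSphere.hsNorm_hessian_sq hfF hF (hF2 θ (UnitSphere.coe_ne_zero θ))
  have hR : (fun θ => f θ * (UnitSphere.laplacian (UnitSphere.laplacian f) θ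
      + ((n : ℝ) - 2) * UnitSphere.laplacian f θ))
      = fun θ : UnitSphere n => F θ * lap G θ + ((n : ℝ) - 2) * (F θ * lap F θ) := by
    ext θ
    rw [hlap, hlap2, hfF]
    ring
  have i1 := (hF4.hessSq (m := 2)).integrable_sphere
  have i2 := ((hF4.gradDot (m := 3) hF4).integrable_sphere).const_mul 2
  have i3 := ((hF4.of_le (Nat.zero_le 4)).mul hG2.lap).integrable_sphere
  have i4 := ((hF2.mul (hF4.lap (m := 2))).integrable_sphere).const_mul ((n : ℝ) - 2)
  have hc : ((volume : Measure (EuclideanSpace ℝ (Fin n))).toSphere Set.univ)⁻¹ ≠ ⊤ :=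
    ENNReal.inv_ne_top.2 (Measure.measure_univ_ne_zero.2 (Measure.toSphere_ne_zero _))
  rw [hL, hR, UnitSphere.sigma]
  refine ⟨(i1.sub i2).smul_measure hc, (i3.add i4).smul_measure hc, ?_⟩
  rw [integral_smul_measure, integral_smul_measure, integral_sub i1 i2, integral_add i3 i4,
    integral_const_mul, integral_const_mul]
  congr 1
  have h1 := integral_mul_lap hF hG hF2 hG2
  have h2 := integral_mul_lap hG hF hG2 hF2
  have h3 := integral_mul_lap hF hF hF2 hF2
  have h4 := integral_lap_sq hF (hF4.of_le (by norm_num))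
  have h5 : gradDot G F = gradDot F G := by
    ext x
    exact Finset.sum_congr rfl fun i _ => mul_comm _ _
  simp only [hGθ] at h2
  rw [h5] at h2
  rw [h1, ← h2, h3, h4]
  ring
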